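/- Let $p$ be an odd prime, $q=p^s$ with $s\ge 1$, $\mathbb F_q$ the finite field with $q$ elements and $\chi$ its quadratic character (so $\chi(0)=0$, and for $a\neq 0$, $\chi(a)=1$ if $a$ is a square and $\chi(a)=-1$ otherwise). For an integer $k\ge 0$ put $$\widetilde N^*(k,0)=\#\{(x_1,\dots,x_k)\in(\mathbb F_q^*)^k : x_1^2+\cdots+x_k^2=0,\ x_i\neq x_j \text{ for } i\neq j\},$$ and $(x)_k=x(x-1)\cdots(x-k+1)$. For $c_1,\dots,c_k\geq 0$ with $\sum_i i c_i=k$ let $N(c_1,\dots,c_k)$ be the number of permutations in $S_k$ having exactly $c_i$ cycles of length $i$ for every $1\le i\le k$ (fixed points being cycles of length $1$), and set $$C_k(t_1,\dots,t_k)=\sum_{\sum i c_i=k}N(c_1,\dots,c_k)\,t_1^{c_1}\cdots t_k^{c_k},\qquad A_{k,1}(u,v,w)=C_k(t_1,\dots,t_k),$$ where $t_i=w$ if $p\mid i$, and, for $p\nmid i$, $t_i=u$ if $\chi(i)=1$ and $t_i=v$ if $\chi(i)=-1$ (with $i$ regarded as an element of $\mathbb F_q$). (1) If $p\equiv 1 \pmod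 4$, or $p\equiv 3\pmod 4$ and $s$ is even, then $$\widetilde N^*(k,0)=\frac{(q-1)_k}{q}+(-1)^k\,\frac{q-1}{2q}\Bigl\{A_{k,1}(1-\sqrt q,\,1+\sqrt q,\,1-q)+A_{k,1}(1+\sqrt q,\,1-\sqrt q,\,1-q)\Bigr\}.$$ (2) If $p\equiv 3\pmod 4$ and $s$ is odd, then $$\widetilde N^*(k,0)=\frac{(q-1)_k}{q}+(-1)^k\,\frac{q-1}{2q}\Bigl\{A_{k,1}(1-\sqrt q\,i,\,1+\sqrt q\,i,\,1-q)+A_{k,1}(1+\sqrt q\,i,\,1-\sqrt q\,i,\,1-q)\Bigr\},$$ where $i=\sqrt{-1}$. -/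

import Mathlib

/-- The number of permutations in `S_k` of type `(c₁, …, c_k)`, that is, having exactly `c_i` cycles
of length `i` for each `1 ≤ i ≤ k` (fixed points are the cycles of length `1`; `σ.partition` records
the lengths of all cycles of `σ`, fixed points included).
The `0`-based index `j : Fin k` stands for `i = j + 1`. -/
def numPermsOfType (k : ℕ) (c : Fin k → ℕ) : ℕ :=
  (Finset.univ.filter fun σ : Equiv.Perm (Fin k) =>
    ∀ j : Fin k, σ.partition.parts.count ((j : ℕ) + 1) = c j).card

/-- The finite set of all tuples `(c₁, …, c_k)` of natural numbers with `∑ i * c_i = k`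
(each entry of such a tuple is automatically at most `k`). -/
def cycleTypes (k : ℕ) : Finset (Fin k → ℕ) :=
  (Fintype.piFinset fun _ : Fin k => Finset.range (k + 1)).filter fun c =>
    ∑ j : Fin k, ((j : ℕ) + 1) * c j = k

/-- `C_k(t₁, …, t_k) = ∑_{∑ i c_i = k} N(c₁, …, c_k) t₁^{c₁} ⋯ t_k^{c_k}`. -/
def cycleGen {R : Type*} [CommRing R] (k : ℕ) (t : Fin k → R) : R :=
  ∑ c ∈ cycleTypes k, (numPermsOfType k c : R) * ∏ j : Fin k, t j ^ c j

/-- `A_{k,b}(u, v, w) = C_k(t₁, …, t_k)`, where `t_i = w` if `p ∣ i`, and, for `p ∤ i`,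
`t_i = u` if `χ(i) = χ(b)` and `t_i = v` if `χ(i) = -χ(b)`. Here `F` is a finite field of odd
characteristic `p`, `χ` is its quadratic character, and `b` is a nonzero element of `F`. -/
def quadCycleGen (F : Type*) [Field F] [Fintype F] [DecidableEq F] {R : Type*} [CommRing R]
    (p k : ℕ) (b : Fˣ) (u v w : R) : R :=
  cycleGen k fun j : Fin k =>
    if p ∣ (j : ℕ) + 1 then w
    else if quadraticChar F (((j : ℕ) + 1 : ℕ) : F) = quadraticChar F (b : F) then u
    else v

/-- The number of `k`-tuples of pairwise distinct nonzero elements of `F` with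
`x₁² + ⋯ + x_k² = b`. -/
def numDistinctNonzeroSols (F : Type*) [Field F] [Fintype F] [DecidableEq F] (k : ℕ) (b : F) : ℕ :=
  (Finset.univ.filter fun x : Fin k → F =>
    (∀ j, x j ≠ 0) ∧ Function.Injective x ∧ ∑ j, x j ^ 2 = b).card

/-! Let ψ be a primitive additive character. By orthogonality, q·Ñ*(k,0) = ∑_a T(a), where T(a) sums
∏ ψ(a x_j²) over tuples of distinct nonzero x_j; T(0) = (q-1)_k is the main term. For a ≠ 0,
distinctness is sieved by a signed sum over permutations (`sum_injective_prod`), so T(a) becomes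
(-1)^k times a sum over S_k of products over cycles, that is, a value of C_k. A cycle of length l
contributes 1 - ∑_x ψ(l a x²): this is 1 - q if p ∣ l, and 1 - χ(l)χ(a)G otherwise, with G the
quadratic Gauss sum. Half of the a ≠ 0 have χ(a) = 1 and half have χ(a) = -1, which gives the two A
terms. Replacing G by -G only exchanges them, so G² = χ(-1)q suffices and the sign of G is never
needed. -/

open Finset Equiv

/-! ### Sieving for distinct coordinates -/

/-- A signed sum over the permutations stabilizing a tuple detects its injectivity. -/
theorem sum_sign_stabilizer_eq_ite_injective {α β R : Type*} [Fintype α] [DecidableEq α]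
    [DecidableEq β] [CommRing R] (x : α → β) [Decidable (Function.Injective x)] :
    ∑ σ : Perm α, (if x ∘ σ = x then ((Perm.sign σ : ℤ) : R) else 0) =
      if Function.Injective x then 1 else 0 := by
  split_ifs with hx
  · rw [Finset.sum_eq_single 1]
    · simp
    · intro σ _ hσ
      rw [if_neg]
      intro h
      exact hσ (Equiv.ext fun i => hx (congrFun h i))
    · simp
  · simp only [Function.Injective, not_forall] at hx
    obtain ⟨i, j, hij, hne⟩ := hx
    have hs : x ∘ swap i j = x := by
      funext l
      simp only [Function.comp_apply, swap_apply_def]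
      split_ifs with h1 h2
      · rw [h1, hij]
      · rw [h2, hij]
      · rfl
    have key (σ : Perm α) : x ∘ (swap i j * σ : Perm α) = x ↔ x ∘ σ = x := by
      have : x ∘ (swap i j * σ : Perm α) = (x ∘ swap i j) ∘ σ := rfl
      rw [this, hs]
    -- Multiplying by a transposition that fixes `x` pairs stabilizing permutations of opposite
    -- sign.
    refine Finset.sum_involution (fun σ _ => swap i j * σ) ?_ ?_ ?_ ?_
    · intro σ _
      simp only [key]
      split_ifs <;> simp [Perm.sign_mul, Perm.sign_swap hne]
    · intro σ _ _ h
      rw [mul_eq_right] at h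
      exact hne (swap_eq_one_iff.1 h)
    · simp
    · simp

/-- The multiset of orbit sizes of a permutation is its cycle partition. -/
theorem prod_card_orbits_eq_prod_parts {α M : Type*} [Fintype α] [DecidableEq α] [CommMonoid M]
    (σ : Perm α) [Fintype (Quotient (Perm.SameCycle.setoid σ))]
    [DecidableEq (Quotient (Perm.SameCycle.setoid σ))] (h : ℕ → M) :
    ∏ o : Quotient (Perm.SameCycle.setoid σ), h (#{i | Quotient.mk _ i = o}) =
      (σ.partition.parts.map h).prod := by
  classical
  set fib : Quotient (Perm.SameCycle.setoid σ) → Finset α :=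
    fun o => ({i | Quotient.mk _ i = o} : Finset α) with hfib
  have mem_fib (i j : α) : j ∈ fib (Quotient.mk _ i) ↔ σ.SameCycle j i := by
    simp only [hfib, mem_filter, mem_univ, true_and]
    exact Quotient.eq
  have inj : Function.Injective fib := by
    intro a b hab
    induction a using Quotient.inductionOn with | _ i => ?_
    have : i ∈ fib b := by rw [← hab]; simp [hfib]
    simpa [hfib] using this
  have of_mem {i : α} (hi : i ∈ σ.support) : fib (Quotient.mk _ i) = (σ.cycleOf i).support := by
    ext j
    rw [mem_fib, Perm.mem_support_cycleOf_iff]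
    exact ⟨fun h => ⟨h.symm, hi⟩, fun h => h.1.symm⟩
  have of_not_mem {i : α} (hi : i ∉ σ.support) : fib (Quotient.mk _ i) = {i} := by
    ext j
    rw [mem_fib, mem_singleton]
    refine ⟨fun h => ?_, fun h => h ▸ Perm.SameCycle.refl _ _⟩
    exact h.eq_of_right (Perm.notMem_support.1 hi)
  have himage : (univ : Finset (Quotient (Perm.SameCycle.setoid σ))).image fib =
      σ.cycleFactorsFinset.image Perm.support ∪ (σ.supportᶜ).image ({·} : α → Finset α) := by
    ext s
    simp only [mem_image, mem_univ, true_and, mem_union, mem_compl]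
    constructor
    · rintro ⟨o, rfl⟩
      induction o using Quotient.inductionOn with | _ i => ?_
      by_cases hi : i ∈ σ.support
      · exact Or.inl ⟨σ.cycleOf i, Perm.cycleOf_mem_cycleFactorsFinset_iff.2 hi, (of_mem hi).symm⟩
      · exact Or.inr ⟨i, hi, (of_not_mem hi).symm⟩
    · rintro (⟨c, hc, rfl⟩ | ⟨i, hi, rfl⟩)
      · obtain ⟨i, hi⟩ := (Perm.mem_cycleFactorsFinset_iff.1 hc).1.nonempty_support
        refine ⟨Quotient.mk _ i, ?_⟩
        rw [of_mem (Perm.mem_cycleFactorsFinset_support_le hc hi), ← Perm.cycle_is_cycleOf hi hc]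
      · exact ⟨Quotient.mk _ i, of_not_mem hi⟩
  have hdisj : Disjoint (σ.cycleFactorsFinset.image Perm.support)
      ((σ.supportᶜ).image ({·} : α → Finset α)) := by
    rw [Finset.disjoint_left]
    rintro _ hA hB
    obtain ⟨c, hc, rfl⟩ := mem_image.1 hA
    obtain ⟨i, -, hi⟩ := mem_image.1 hB
    have h2 := (Perm.mem_cycleFactorsFinset_iff.1 hc).1.two_le_card_support
    rw [← hi] at h2
    simp at h2
  calc ∏ o, h (#(fib o)) = ∏ s ∈ (univ : Finset _).image fib, h (#s) :=
        (Finset.prod_image (f := fun s : Finset α => h #s) inj.injOn).symm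
    _ = (∏ c ∈ σ.cycleFactorsFinset, h (#c.support)) * ∏ i ∈ σ.supportᶜ, h 1 := by
        rw [himage, Finset.prod_union hdisj, Finset.prod_image, Finset.prod_image]
        · simp
        · exact (Finset.singleton_injective).injOn
        · intro c hc d hd hcd
          obtain ⟨i, hi⟩ := (Perm.mem_cycleFactorsFinset_iff.1 hc).1.nonempty_support
          have hi' : i ∈ d.support := by rw [← hcd]; exact hi
          rw [Perm.cycle_is_cycleOf hi hc, Perm.cycle_is_cycleOf hi' hd]
    _ = _ := by
        rw [Perm.parts_partition, Perm.cycleType_def, Multiset.map_add, Multiset.prod_add,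
          Multiset.map_map, Finset.prod_const, Multiset.map_replicate, Multiset.prod_replicate,
          Finset.card_compl]
        rfl

/-- Summing a product weight over the tuples fixed by `σ` gives a product of power sums over the
cycles of `σ`. -/
theorem sum_prod_fixed_eq_prod_parts {α β R : Type*} [Fintype α] [DecidableEq α] [Fintype β]
    [DecidableEq β] [CommRing R] (σ : Perm α) (g : β → R) :
    ∑ x : α → β, (if x ∘ σ = x then ∏ i, g (x i) else 0) =
      (σ.partition.parts.map fun l => ∑ b, g b ^ l).prod := by
  classical
  rw [← prod_card_orbits_eq_prod_parts σ, Finset.prod_univ_sum, ← Finset.sum_filter]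
  rw [Fintype.piFinset_univ]
  symm
  have fixed {x : α → β} (hx : x ∘ σ = x) {i j : α} (h : σ.SameCycle i j) : x i = x j := by
    obtain ⟨n, rfl⟩ := h
    have hn : ∀ n : ℤ, ∀ i, x ((σ ^ n) i) = x i := by
      intro n
      induction n using Int.induction_on with
      | zero => simp
      | succ n ih =>
        intro i
        rw [zpow_add_one, Perm.mul_apply, ih]
        exact congrFun hx i
      | pred n ih =>
        intro i
        rw [zpow_sub_one, Perm.mul_apply, ih]
        have := congrFun hx (σ⁻¹ i)
        simp only [Function.comp_apply, ← Perm.mul_apply, mul_inv_cancel, Perm.one_apply] at this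
        exact this.symm
    exact (hn n i).symm
  refine Finset.sum_bij' (fun y _ i => y (Quotient.mk _ i))
    (fun x hx => Quotient.lift x fun i j h => fixed (mem_filter.1 hx).2 h) ?_ ?_ ?_ ?_ ?_
  · intro y _
    simp only [mem_filter, mem_univ, true_and]
    funext i
    refine congrArg y (Quotient.sound ?_)
    exact (Perm.sameCycle_apply_left.2 (Perm.SameCycle.refl σ i))
  · simp
  · intro y _
    funext o
    induction o using Quotient.inductionOn with | _ i => rfl
  · intro x _
    rfl
  · intro y _
    rw [← Finset.prod_fiberwise_of_maps_to (s := univ) (t := univ)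
      (g := fun i : α => (Quotient.mk (Perm.SameCycle.setoid σ) i)) (fun _ _ => mem_univ _)]
    refine Finset.prod_congr rfl fun o _ => ?_
    rw [← Finset.prod_const]
    refine Finset.prod_congr rfl fun i hi => ?_
    exact congrArg (fun o => g (y o)) (mem_filter.1 hi).2.symm

/-- The sign is (-1)^(n - number of cycles), so it distributes as one factor -1 per cycle, fixed
points included. -/
theorem sign_eq_prod_parts {α R : Type*} [Fintype α] [DecidableEq α] [CommRing R] (σ : Perm α) :
    ((Perm.sign σ : ℤ) : R) =
      (-1) ^ Fintype.card α * (σ.partition.parts.map fun _ => (-1 : R)).prod := by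
  have hle : #σ.support ≤ Fintype.card α := Finset.card_le_univ _
  obtain ⟨d, hd⟩ := Nat.exists_eq_add_of_le hle
  rw [Perm.sign_of_cycleType, Perm.parts_partition, Perm.sum_cycleType, Multiset.map_const',
    Multiset.prod_replicate, Multiset.card_add, Multiset.card_replicate, hd,
    Nat.add_sub_cancel_left]
  push_cast
  have : ((-1 : R) ^ d) * (-1) ^ d = 1 := by rw [← mul_pow]; simp
  linear_combination (-(-1 : R) ^ (#σ.support + Multiset.card σ.cycleType)) * this

/-- Sieve formula for the distinct-coordinate sum of a product weight. -/
theorem sum_injective_prod {α β R : Type*} [Fintype α] [DecidableEq α] [Fintype β]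
    [DecidableEq β] [CommRing R] (g : β → R) [DecidablePred (Function.Injective (α := α) (β := β))] :
    ∑ x : α → β, (if Function.Injective x then ∏ i, g (x i) else 0) =
      (-1) ^ Fintype.card α *
        ∑ σ : Perm α, (σ.partition.parts.map fun l => -∑ b, g b ^ l).prod := by
  have h1 (x : α → β) : (if Function.Injective x then ∏ i, g (x i) else 0) =
      ∑ σ : Perm α, ((Perm.sign σ : ℤ) : R) * (if x ∘ σ = x then ∏ i, g (x i) else 0) := by
    rw [← one_mul (∏ i, g (x i)), ← ite_zero_mul, ← sum_sign_stabilizer_eq_ite_injective,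
      Finset.sum_mul]
    refine Finset.sum_congr rfl fun σ _ => ?_
    split_ifs <;> simp
  simp_rw [h1]
  rw [Finset.sum_comm, Finset.mul_sum]
  refine Finset.sum_congr rfl fun σ _ => ?_
  rw [← Finset.mul_sum, sum_prod_fixed_eq_prod_parts, sign_eq_prod_parts, mul_assoc,
    ← Multiset.prod_map_mul]
  simp

/-- Grouping permutations by cycle type turns the sieve output into C_k. -/
theorem cycleGen_eq_sum_perm {R : Type*} [CommRing R] (k : ℕ) (t : ℕ → R) :
    cycleGen k (fun j : Fin k => t (j + 1)) =
      ∑ σ : Perm (Fin k), (σ.partition.parts.map t).prod := by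
  classical
  have hparts (σ : Perm (Fin k)) {l : ℕ} (hl : l ∈ σ.partition.parts) : 0 < l ∧ l ≤ k := by
    refine ⟨σ.partition.parts_pos hl, ?_⟩
    have := Multiset.le_sum_of_mem hl
    rwa [σ.partition.parts_sum, Fintype.card_fin] at this
  have hsub (σ : Perm (Fin k)) : σ.partition.parts.toFinset ⊆
      univ.image fun j : Fin k => (j : ℕ) + 1 := by
    intro l hl
    obtain ⟨h0, hk⟩ := hparts σ (Multiset.mem_toFinset.1 hl)
    exact mem_image.2 ⟨⟨l - 1, by omega⟩, mem_univ _, by simp; omega⟩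
  have hinj : Function.Injective fun j : Fin k => (j : ℕ) + 1 := by
    intro a b h
    exact Fin.ext (by simpa using h)
  have hprod (σ : Perm (Fin k)) : (σ.partition.parts.map t).prod =
      ∏ j : Fin k, t (j + 1) ^ σ.partition.parts.count ((j : ℕ) + 1) := by
    rw [Finset.prod_multiset_map_count, Finset.prod_subset (hsub σ), Finset.prod_image hinj.injOn]
    intro l _ hl
    rw [Multiset.count_eq_zero.2 (by simpa using hl), pow_zero]
  have hsum (σ : Perm (Fin k)) :
      ∑ j : Fin k, ((j : ℕ) + 1) * σ.partition.parts.count ((j : ℕ) + 1) = k := by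
    have := σ.partition.parts_sum.trans (Fintype.card_fin k)
    rw [Finset.sum_multiset_count, Finset.sum_subset (hsub σ),
      Finset.sum_image hinj.injOn] at this
    · simpa [mul_comm] using this
    · intro l _ hl
      rw [Multiset.count_eq_zero.2 (by simpa using hl), zero_smul]
  have hmaps : ∀ σ ∈ (univ : Finset (Perm (Fin k))),
      (fun j : Fin k => σ.partition.parts.count ((j : ℕ) + 1)) ∈ cycleTypes k := by
    intro σ _
    refine mem_filter.2 ⟨Fintype.mem_piFinset.2 fun j => mem_range.2 ?_, hsum σ⟩
    -- The bound c_j ≤ (j + 1) c_j ≤ k places each count in `range (k + 1)`.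
    have := Finset.single_le_sum
      (f := fun j : Fin k => ((j : ℕ) + 1) * σ.partition.parts.count ((j : ℕ) + 1))
      (fun _ _ => Nat.zero_le _) (mem_univ j)
    rw [hsum] at this
    nlinarith
  rw [cycleGen, ← Finset.sum_fiberwise_of_maps_to hmaps]
  refine Finset.sum_congr rfl fun c _ => ?_
  rw [numPermsOfType, ← nsmul_eq_mul, ← Finset.sum_const]
  refine Finset.sum_congr (by ext σ; simp [funext_iff]) fun σ hσ => ?_
  rw [hprod]
  have h := (mem_filter.1 hσ).2
  refine Finset.prod_congr rfl fun j _ => ?_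
  rw [congrFun h j] 

/-! ### Quadratic Gauss sums -/

theorem sum_comp_sq {F R : Type*} [Field F] [Fintype F] [DecidableEq F] [CommRing R]
    (hF : ringChar F ≠ 2) (f : F → R) :
    ∑ x, f (x ^ 2) = ∑ y, ((quadraticChar F y : ℤ) + 1 : R) * f y := by
  rw [← Finset.sum_fiberwise_of_maps_to (s := univ) (t := univ) (g := fun x : F => x ^ 2)
    (fun _ _ => mem_univ _)]
  refine Finset.sum_congr rfl fun y _ => ?_
  have h := congrArg (Int.cast : ℤ → R) (quadraticChar_card_sqrts hF y)
  push_cast at h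
  rw [← h, ← nsmul_eq_mul, ← Finset.sum_const]
  refine Finset.sum_congr (by ext x; simp) fun x hx => ?_
  have hxy : x ^ 2 = y := by simpa using hx
  rw [hxy]

/-- The quadratic character with values in `ℂ`. -/
noncomputable def complexQuadraticChar (F : Type*) [Field F] [Fintype F] [DecidableEq F] :
    MulChar F ℂ :=
  (quadraticChar F).ringHomComp (Int.castRingHom ℂ)

/-- Each y has 1 + χ(y) square roots. The part from 1 vanishes by orthogonality, and rescaling y in
the other gives χ(b)⁻¹ = χ(b) times the Gauss sum. -/
theorem sum_addChar_mul_sq {F : Type*} [Field F] [Fintype F] [DecidableEq F]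
    (hF : ringChar F ≠ 2) {ψ : AddChar F ℂ} (hψ : ψ.IsPrimitive) {b : F} (hb : b ≠ 0) :
    ∑ x, ψ (b * x ^ 2) = (quadraticChar F b : ℤ) * gaussSum (complexQuadraticChar F) ψ := by
  rw [sum_comp_sq hF fun y => ψ (b * y)]
  have h0 : ∑ y, ψ (b * y) = 0 := by
    simp_rw [mul_comm b]
    rw [AddChar.sum_mulShift b hψ, if_neg hb, Nat.cast_zero]
  have h1 := gaussSum_mulShift (complexQuadraticChar F) ψ (Units.mk0 b hb)
  have h2 : gaussSum (complexQuadraticChar F) (ψ.mulShift b) =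
      ∑ y, ((quadraticChar F y : ℤ) : ℂ) * ψ (b * y) := rfl
  have h3 : complexQuadraticChar F b = ((quadraticChar F b : ℤ) : ℂ) := rfl
  have h4 : ((quadraticChar F b : ℤ) : ℂ) ^ 2 = 1 := by
    exact_mod_cast quadraticChar_sq_one hb
  simp only [Units.val_mk0, h3, h2] at h1
  simp_rw [add_mul, Finset.sum_add_distrib, one_mul]
  rw [h0, ← h1]
  linear_combination (-∑ y, ((quadraticChar F y : ℤ) : ℂ) * ψ (b * y)) * h4

theorem gaussSum_complexQuadraticChar_sq {F : Type*} [Field F] [Fintype F] [DecidableEq F]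
    (hF : ringChar F ≠ 2) {ψ : AddChar F ℂ} (hψ : ψ.IsPrimitive) :
    gaussSum (complexQuadraticChar F) ψ ^ 2 =
      (quadraticChar F (-1) : ℤ) * (Fintype.card F : ℂ) := by
  have hinj : Function.Injective (Int.castRingHom ℂ) := Int.cast_injective
  exact gaussSum_sq ((MulChar.ringHomComp_ne_one_iff hinj).2 (quadraticChar_ne_one hF))
    ((quadraticChar_isQuadratic F).comp _) hψ

/-- The sum of the additive character `x ↦ ψ (a (x₁² + ⋯ + x_k²))` over tuples of distinct nonzero
elements. -/
theorem sum_addChar_distinct_nonzero {F : Type*} [Field F] [Fintype F] [DecidableEq F]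
    (p : ℕ) [CharP F p] (hF : ringChar F ≠ 2) {ψ : AddChar F ℂ} (hψ : ψ.IsPrimitive)
    (k : ℕ) {a : F} (ha : a ≠ 0) :
    ∑ x : Fin k → F, (if Function.Injective x then
        ∏ j, (if x j = 0 then 0 else ψ (a * x j ^ 2)) else 0) =
      (-1) ^ k * quadCycleGen F p k 1
        (1 - (quadraticChar F a : ℤ) * gaussSum (complexQuadraticChar F) ψ)
        (1 + (quadraticChar F a : ℤ) * gaussSum (complexQuadraticChar F) ψ)
        (1 - (Fintype.card F : ℂ)) := by
  rw [sum_injective_prod (fun x : F => if x = 0 then 0 else ψ (a * x ^ 2)), quadCycleGen]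
  -- The -1 removes x = 0, where ψ equals 1 but the weight is 0; this needs 0 ^ l = 0.
  have hpow {l : ℕ} (hl : l ≠ 0) : ∑ x : F, (if x = 0 then 0 else ψ (a * x ^ 2)) ^ l =
      ∑ x, ψ ((l * a : F) * x ^ 2) - 1 := by
    have h (x : F) : (if x = 0 then 0 else ψ (a * x ^ 2)) ^ l =
        ψ ((l * a : F) * x ^ 2) - if x = 0 then 1 else 0 := by
      split_ifs with hx
      · simp [hx, hl]
      · rw [← AddChar.map_nsmul_eq_pow, nsmul_eq_mul, mul_assoc, sub_zero]
    simp [h, Finset.sum_sub_distrib]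
  have hchar {l : ℕ} (hl : l ≠ 0) : -∑ x : F, (if x = 0 then 0 else ψ (a * x ^ 2)) ^ l =
      if p ∣ l then 1 - (Fintype.card F : ℂ)
      else if quadraticChar F (l : F) = quadraticChar F ((1 : Fˣ) : F) then
        1 - (quadraticChar F a : ℤ) * gaussSum (complexQuadraticChar F) ψ
      else 1 + (quadraticChar F a : ℤ) * gaussSum (complexQuadraticChar F) ψ := by
    rw [hpow hl, Units.val_one, map_one]
    split_ifs with h1 h2
    · simp [(CharP.cast_eq_zero_iff F p l).2 h1]
    · have hl' : (l : F) ≠ 0 := mt (CharP.cast_eq_zero_iff F p l).1 h1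
      rw [sum_addChar_mul_sq hF hψ (mul_ne_zero hl' ha), map_mul, h2]
      push_cast
      ring
    · have hl' : (l : F) ≠ 0 := mt (CharP.cast_eq_zero_iff F p l).1 h1
      rw [sum_addChar_mul_sq hF hψ (mul_ne_zero hl' ha), map_mul,
        (quadraticChar_eq_neg_one_iff_not_one hl').2 h2]
      push_cast
      ring
  rw [← cycleGen_eq_sum_perm k]
  congr 2
  · exact Fintype.card_fin k
  funext j
  exact hchar (Nat.succ_ne_zero j)

/-! ### Summing over the frequency a and counting solutions -/

theorem sum_ne_zero_comp_quadraticChar {F R : Type*} [Field F] [Fintype F] [DecidableEq F]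
    [Field R] [CharZero R] (hF : ringChar F ≠ 2) (f : ℤ → R) :
    ∑ a ∈ univ.erase (0 : F), f (quadraticChar F a) =
      ((Fintype.card F : R) - 1) / 2 * (f 1 + f (-1)) := by
  -- On {1, -1} every function is affine in χ(a), and ∑ χ(a) = 0.
  have h (a : F) (ha : a ∈ univ.erase (0 : F)) : f (quadraticChar F a) =
      (f 1 + f (-1)) / 2 + (quadraticChar F a : ℤ) * ((f 1 - f (-1)) / 2) := by
    rcases quadraticChar_dichotomy (Finset.ne_of_mem_erase ha) with h | h <;> rw [h] <;>
      push_cast <;> ring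
  have hsum : ∑ a ∈ univ.erase (0 : F), ((quadraticChar F a : ℤ) : R) = 0 := by
    have h0 := quadraticChar_sum_zero hF
    rw [← Finset.add_sum_erase _ _ (mem_univ (0 : F)), quadraticChar_zero, zero_add] at h0
    exact_mod_cast h0
  have hcard : ((#(univ.erase (0 : F)) : ℕ) : R) = Fintype.card F - 1 := by
    rw [Finset.card_erase_of_mem (mem_univ _), Finset.card_univ,
      Nat.cast_sub Fintype.card_pos, Nat.cast_one]
  rw [Finset.sum_congr rfl h, Finset.sum_add_distrib, ← Finset.sum_mul, hsum, Finset.sum_const,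
    nsmul_eq_mul, hcard]
  ring

theorem card_injective_nonzero (F : Type*) [Field F] [Fintype F] [DecidableEq F] (k : ℕ) :
    #{x : Fin k → F | Function.Injective x ∧ ∀ j, x j ≠ 0} =
      (Fintype.card F - 1).descFactorial k := by
  have h := Fintype.card_embedding_eq (α := Fin k) (β := Fˣ)
  rw [Fintype.card_units, Fintype.card_fin] at h
  rw [← h, ← Finset.card_univ]
  symm
  refine Finset.card_bij (fun e _ j => (e j : F)) ?_ ?_ ?_
  · intro e _
    simp only [mem_filter, mem_univ, true_and]
    exact ⟨fun i j hij => e.injective (Units.ext hij), fun j => (e j).ne_zero⟩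
  · intro e _ e' _ h
    ext j
    exact congrFun h j
  · intro x hx
    obtain ⟨hinj, hx0⟩ := (mem_filter.1 hx).2
    refine ⟨⟨fun j => Units.mk0 (x j) (hx0 j), fun i j hij => hinj ?_⟩, mem_univ _, rfl⟩
    simpa using hij

theorem addChar_sum_eq_prod {ι A M : Type*} [AddCommMonoid A] [CommMonoid M] (ψ : AddChar A M)
    (s : Finset ι) (f : ι → A) : ψ (∑ i ∈ s, f i) = ∏ i ∈ s, ψ (f i) :=
  map_prod ψ.toMonoidHom (fun i => Multiplicative.ofAdd (f i)) s

/-- Any square root `r` of χ(-1)q is allowed: it equals G or -G, and the two summands are exchanged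
under r ↦ -r. -/
theorem numDistinctNonzeroSols_zero_eq {F : Type*} [Field F] [Fintype F] [DecidableEq F]
    (p : ℕ) [CharP F p] (hF : ringChar F ≠ 2) (k : ℕ) {r : ℂ}
    (hr : r ^ 2 = (quadraticChar F (-1) : ℤ) * (Fintype.card F : ℂ)) :
    (numDistinctNonzeroSols F k 0 : ℂ) =
      ((Fintype.card F - 1).descFactorial k : ℂ) / Fintype.card F +
        (-1) ^ k * (((Fintype.card F : ℂ) - 1) / (2 * Fintype.card F)) *
          (quadCycleGen F p k 1 (1 - r) (1 + r) (1 - (Fintype.card F : ℂ)) +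
            quadCycleGen F p k 1 (1 + r) (1 - r) (1 - (Fintype.card F : ℂ))) := by
  set ψ := AddChar.FiniteField.primitiveChar_to_Complex F
  have hψ : ψ.IsPrimitive := AddChar.FiniteField.primitiveChar_to_Complex_isPrimitive F
  set q : ℂ := (Fintype.card F : ℂ) with hq
  set G := gaussSum (complexQuadraticChar F) ψ with hG
  have hq0 : q ≠ 0 := Nat.cast_ne_zero.2 Fintype.card_ne_zero
  set T : F → ℂ := fun a => ∑ x : Fin k → F, (if Function.Injective x then
        ∏ j, (if x j = 0 then 0 else ψ (a * x j ^ 2)) else 0) with hT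
  have hterm (a : F) (x : Fin k → F) : (if Function.Injective x then
        ∏ j, (if x j = 0 then 0 else ψ (a * x j ^ 2)) else 0) =
      if Function.Injective x ∧ ∀ j, x j ≠ 0 then ψ (a * ∑ j, x j ^ 2) else 0 := by
    by_cases hi : Function.Injective x
    · by_cases h0 : ∀ j, x j ≠ 0
      · rw [if_pos hi, if_pos ⟨hi, h0⟩, Finset.mul_sum, addChar_sum_eq_prod]
        exact Finset.prod_congr rfl fun j _ => if_neg (h0 j)
      · rw [if_pos hi, if_neg fun h => h0 h.2]
        push Not at h0
        obtain ⟨j, hj⟩ := h0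
        exact Finset.prod_eq_zero (mem_univ j) (if_pos hj)
    · rw [if_neg hi, if_neg fun h => hi h.1]
  have hcount : ∑ a, T a = q * numDistinctNonzeroSols F k 0 := by
    simp_rw [hT, hterm]
    rw [Finset.sum_comm, numDistinctNonzeroSols, Finset.card_filter, Nat.cast_sum, Finset.mul_sum]
    refine Finset.sum_congr rfl fun x _ => ?_
    by_cases h : Function.Injective x ∧ ∀ j, x j ≠ 0
    · simp_rw [if_pos h]
      rw [AddChar.sum_mulShift _ hψ]
      by_cases h' : ∑ j, x j ^ 2 = 0
      · rw [if_pos h', if_pos ⟨h.2, h.1, h'⟩, Nat.cast_one, mul_one]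
      · rw [if_neg h', if_neg fun h'' => h' h''.2.2, Nat.cast_zero, mul_zero]
    · simp_rw [if_neg h]
      rw [if_neg fun h'' => h ⟨h''.2.1, h''.1⟩, Finset.sum_const_zero, Nat.cast_zero, mul_zero]
  have hzero : T 0 = ((Fintype.card F - 1).descFactorial k : ℂ) := by
    simp_rw [hT, hterm, zero_mul, AddChar.map_zero_eq_one]
    rw [← card_injective_nonzero, Finset.card_filter]
    push_cast
    rfl
  have hnonzero : ∑ a ∈ univ.erase (0 : F), T a = (q - 1) / 2 *
      ((-1) ^ k * quadCycleGen F p k 1 (1 - G) (1 + G) (1 - q) +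
        (-1) ^ k * quadCycleGen F p k 1 (1 + G) (1 - G) (1 - q)) := by
    have := sum_ne_zero_comp_quadraticChar (R := ℂ) hF fun e =>
      (-1) ^ k * quadCycleGen F p k 1 (1 - e * G) (1 + e * G) (1 - q)
    rw [Finset.sum_congr rfl fun a ha =>
      sum_addChar_distinct_nonzero p hF hψ k (Finset.ne_of_mem_erase ha), this]
    simp [sub_eq_add_neg, hq]
  have hsum := Finset.add_sum_erase univ T (mem_univ (0 : F))
  rw [hcount, hzero, hnonzero] at hsum
  have hsq : r ^ 2 = G ^ 2 := by rw [hr, hG, gaussSum_complexQuadraticChar_sq hF hψ]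
  have hmain : (numDistinctNonzeroSols F k 0 : ℂ) =
      ((Fintype.card F - 1).descFactorial k : ℂ) / q + (-1) ^ k * ((q - 1) / (2 * q)) *
          (quadCycleGen F p k 1 (1 - G) (1 + G) (1 - q) +
            quadCycleGen F p k 1 (1 + G) (1 - G) (1 - q)) := by
    field_simp
    linear_combination (-2) * hsum
  rw [hmain]
  rcases sq_eq_sq_iff_eq_or_eq_neg.1 hsq with rfl | rfl
  · rfl
  · rw [sub_neg_eq_add, ← sub_eq_add_neg, add_comm (quadCycleGen F p k 1 (1 + G) _ _)]

/-- Used to bring the complex identity back to ℝ when √q is real. -/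
theorem map_quadCycleGen {F R S : Type*} [Field F] [Fintype F] [DecidableEq F] [CommRing R]
    [CommRing S] (φ : R →+* S) (p k : ℕ) (b : Fˣ) (u v w : R) :
    φ (quadCycleGen F p k b u v w) = quadCycleGen F p k b (φ u) (φ v) (φ w) := by
  simp only [quadCycleGen, cycleGen, map_sum, map_mul, map_natCast, map_prod, map_pow, apply_ite φ]

theorem theorem4p4 {F : Type*} [Field F] [Fintype F] [DecidableEq F]
    (p s q : ℕ) (hp : p.Prime) (hq : q = p ^ s) (hF : Fintype.card F = q) (k : ℕ) :
    ((p ≡ 1 [MOD 4] ∨ (p ≡ 3 [MOD 4] ∧ Even s)) →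
      (numDistinctNonzeroSols F k 0 : ℝ) =
        ((q - 1).descFactorial k : ℝ) / q +
          (-1) ^ k * (((q : ℝ) - 1) / (2 * q)) *
            (quadCycleGen F p k 1 (1 - √(q : ℝ)) (1 + √(q : ℝ)) (1 - (q : ℝ)) +
              quadCycleGen F p k 1 (1 + √(q : ℝ)) (1 - √(q : ℝ)) (1 - (q : ℝ)))) ∧
    ((p ≡ 3 [MOD 4] ∧ Odd s) →
      (numDistinctNonzeroSols F k 0 : ℂ) =
        ((q - 1).descFactorial k : ℂ) / q +
          (-1) ^ k * (((q : ℂ) - 1) / (2 * q)) *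
            (quadCycleGen F p k 1 (1 - ((√(q : ℝ) : ℝ) : ℂ) * Complex.I)
                (1 + ((√(q : ℝ) : ℝ) : ℂ) * Complex.I) (1 - (q : ℂ)) +
              quadCycleGen F p k 1 (1 + ((√(q : ℝ) : ℝ) : ℂ) * Complex.I)
                (1 - ((√(q : ℝ) : ℝ) : ℂ) * Complex.I) (1 - (q : ℂ)))) := by
  have : Fact p.Prime := ⟨hp⟩
  have : CharP F p := charP_of_card_eq_prime_pow (hF.trans hq)
  have hring : ringChar F = p := ringChar.eq F p ▸ rfl
  have hsqrt : (((√(q : ℝ) : ℝ) : ℂ)) ^ 2 = q := by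
    rw [← Complex.ofReal_pow, Real.sq_sqrt (Nat.cast_nonneg q), Complex.ofReal_natCast]
  have hp2 (h : p % 4 = 1 ∨ p % 4 = 3) : ringChar F ≠ 2 := by
    rw [hring]
    omega
  constructor
  · intro h
    have hq4 : q % 4 = 1 := by
      rw [hq]
      rcases h with h | ⟨h, t, rfl⟩
      · exact (h.pow s).trans (by rw [one_pow])
      · rw [← two_mul, pow_mul]
        exact ((h.pow 2).pow t).trans (show (3 ^ 2) ^ t ≡ 1 [MOD 4] from
          ((show 3 ^ 2 ≡ 1 [MOD 4] by decide).pow t).trans (by rw [one_pow]))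
    have hchar := hp2 (h.imp id And.left)
    -- -1 is a square exactly when q is not 3 mod 4; hence `r` = √q here and √q·i in the other case.
    have hneg : quadraticChar F (-1) = 1 := by
      rw [quadraticChar_one_iff_isSquare (neg_ne_zero.2 one_ne_zero),
        FiniteField.isSquare_neg_one_iff, hF, hq4]
      decide
    have hmain := numDistinctNonzeroSols_zero_eq p hchar k (r := ((√(q : ℝ) : ℝ) : ℂ))
      (by rw [hneg, hF, hsqrt, Int.cast_one, one_mul])
    rw [hF] at hmain
    apply Complex.ofReal_injective
    have hmap (u v w : ℝ) : ((quadCycleGen F p k 1 u v w : ℝ) : ℂ) =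
        quadCycleGen F p k 1 (u : ℂ) (v : ℂ) (w : ℂ) :=
      map_quadCycleGen Complex.ofRealHom p k 1 u v w
    push_cast [hmap]
    exact hmain
  · rintro ⟨h, t, rfl⟩
    have hq4 : q % 4 = 3 := by
      rw [hq, pow_succ, pow_mul]
      have h1 : (p ^ 2) ^ t ≡ 1 [MOD 4] := ((h.pow 2).pow t).trans
        (((show 3 ^ 2 ≡ 1 [MOD 4] by decide).pow t).trans (by rw [one_pow]))
      exact h1.mul h
    have hchar := hp2 (Or.inr h)
    have hneg : quadraticChar F (-1) = -1 := by
      rw [quadraticChar_neg_one_iff_not_isSquare, FiniteField.isSquare_neg_one_iff, hF, hq4]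
      decide
    have hmain := numDistinctNonzeroSols_zero_eq p hchar k
      (r := ((√(q : ℝ) : ℝ) : ℂ) * Complex.I)
      (by rw [hneg, hF, mul_pow, hsqrt, Complex.I_sq]; push_cast; ring)
    rw [hF] at hmain
    exact hmain
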